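/- Let $\mathbb F_2$ be the field with two elements. A linear code $C\le\mathbb F_2^n$ has \emph{parity-check density at most $w$} if $C=\{x\in\mathbb F_2^n : Ax=0\}$ for some matrix $A$ over $\mathbb F_2$ all of whose rows have Hamming weight at most $w$; it has \emph{relative minimum distance at least $\delta$} if any two distinct elements of $C$ differ in at least $\delta n$ coordinates. For a positive integer $w$ and $\delta\in(0,\tfrac12)$ let $$R_w(\delta)=\limsup_{n\to\infty}\ \max_{C}\ \frac{\log_2|C|}{n},$$ where $C$ ranges over all linear codes $C\le\mathbb F_2^n$ with parity-check density at most $w$ and relative minimum distance at least $\delta$. **Theorem.** Let $0<\delta<\tfrac12$ and set $\rho=\tfrac12-\sqrt{\delta(1-\delta)}$. Then, for every integer $w\ge 3$, $$R_w(\delta)\le H(\rho)-\frac1w\log_2\left(1+\left(\frac{\rho}{1-\rho}\right)^w\right).$$ Moreover, $$R_3(\delta)\le\begin{cases}\dfrac23, & \delta\le\dfrac12-\dfrac{\sqrt3}{4},\\[8pt] \dfrac23\,H_4(3\rho), & \delta>\dfrac12-\dfrac{\sqrt3}{4},\end{cases}$$ and $$R_4(\delta)\le H(\rho)+\frac14\log_2F(\rho),$$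 where $H(x)=-x\log_2x-(1-x)\log_2(1-x)$, $H_4(x)=x\log_43-x\log_4x-(1-x)\log_4(1-x)$ and $F(\rho)=(1-\rho)^4+4\rho(1-\rho)^3+6\rho^2(1-\rho)^2$. -/

import Mathlib

namespace LDPC

/-- A binary linear code of block length `n`: a linear subspace of `𝔽₂ⁿ`. -/
abbrev BinaryCode (n : ℕ) : Type := Submodule (ZMod 2) (Fin n → ZMod 2)

/-- `C` has parity-check density at most `w`: it admits a parity-check matrix all of whose rows
have Hamming weight at most `w`. -/
def HasParityCheckDensity {n : ℕ} (w : ℕ) (C : BinaryCode n) : Prop :=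
  ∃ (m : ℕ) (A : Matrix (Fin m) (Fin n) (ZMod 2)),
    (∀ i : Fin m, hammingNorm (A i) ≤ w) ∧
      ∀ x : Fin n → ZMod 2, x ∈ C ↔ A.mulVec x = 0

/-- `C` has relative minimum distance at least `δ`: any two distinct codewords differ in at least
`δ n` coordinates. -/
def HasRelativeDistance {n : ℕ} (δ : ℝ) (C : BinaryCode n) : Prop :=
  ∀ x ∈ C, ∀ y ∈ C, x ≠ y → δ * (n : ℝ) ≤ (hammingDist x y : ℝ)

/-- The rate `(1/n) log₂ |C|` of a code. -/
noncomputable def codeRate {n : ℕ} (C : BinaryCode n) : ℝ :=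
  Real.logb 2 (Nat.card C : ℝ) / (n : ℝ)

/-- The largest rate of a binary linear code of length `n` with parity-check density at most `w`
and relative minimum distance at least `δ`. There are finitely many such codes, and the zero code
is always one of them, so this supremum is a maximum. -/
noncomputable def maxRate (w : ℕ) (δ : ℝ) (n : ℕ) : ℝ :=
  sSup {r : ℝ | ∃ C : BinaryCode n,
    HasParityCheckDensity w C ∧ HasRelativeDistance δ C ∧ r = codeRate C}

/-- `R_w(δ)`, the largest asymptotically achievable rate. All rates lie in `[0, 1]`, so the upper
limit is that of a bounded sequence. -/
noncomputable def asymptoticRate (w : ℕ) (δ : ℝ) : ℝ :=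
  Filter.limsup (fun n : ℕ => maxRate w δ n) Filter.atTop

/-- The binary entropy function `H`, with logarithms in base two. -/
noncomputable def entropy2 (x : ℝ) : ℝ :=
  -x * Real.logb 2 x - (1 - x) * Real.logb 2 (1 - x)

/-- The quaternary entropy function `H₄`, with logarithms in base four. -/
noncomputable def entropy4 (x : ℝ) : ℝ :=
  x * Real.logb 4 3 - x * Real.logb 4 x - (1 - x) * Real.logb 4 (1 - x)

/-- `F(ρ) = (1 - ρ)⁴ + 4ρ(1 - ρ)³ + 6ρ²(1 - ρ)²`. -/
noncomputable def quarticF (ρ : ℝ) : ℝ :=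
  (1 - ρ) ^ 4 + 4 * ρ * (1 - ρ) ^ 3 + 6 * ρ ^ 2 * (1 - ρ) ^ 2

end LDPC

/-!
Let `C` be the kernel of a matrix `A` with rows of weight at most `w`, let `D` be its row space, and
consider the coset graph of `D`: the Cayley graph of `𝔽₂ⁿ / D` generated by the unit vectors. It has
at least `|C|` vertices, and its distances from the identity are the least weights in the cosets
(`cosetWeight`). Two facts about the balls of this graph give the theorem.

*Large balls* (the argument of Friedman and Tillich for the first linear programming bound). The
eigenvalues of the coset graph are `n - 2|y|` for `y ∈ C`, hence at most `(1 - 2δ)n` apart from the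
trivial one. A radial function on the Hamming cube supported on levels up to `(ρ + ε)n` can have
eigenvalue slightly above `2 √(ρ(1 - ρ)) n = (1 - 2δ)n` (`bandProfile_subharmonic`). Pushed forward
to the coset graph it lives on a ball of the same radius, and comparing the quadratic form of the
adjacency operator with the spectral gap shows that this ball contains at least the fraction `1 / n`
of all vertices (`two_pow_le_card_cosetWeight_le`).

*Small balls.* The ball of radius `r` has at most `z ^ (-r) W` elements, where `W` is the sum of
`z ^ |g|` over the cosets `g`, and `0 < z ≤ 1`. The sum `W` is bounded by adjoining the rows of `A`
one at a time. When a row `c` covers `s` new coordinates and meets the old ones in a vector `u` with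
`|u| ≤ w - s`, each coset `g` of the old code is paired with `g + u`, whose weight differs from that
of `g` by at most `w - s`. With `x` the new coordinates, `(g, x)` and `(g + u, x + 1)` become equal,
so the new weight is at least the smaller of the two
(`sum_pow_cosetWeight_sup_span_le`). Hence `W ≤ G ^ n` as soon as `G` satisfies the finitely many
elementary inequalities collected in `IsGrowthBound`, because every coordinate is covered when `C`
has no word of weight one (`sum_pow_cosetWeight_span_le`). Admissible values are
`G = (1 + z) / (1 + z ^ w) ^ (1 / w)` for all `w`, `G = (1 + 3z) ^ (1 / 3)` for `w = 3`, and
`G = (1 + 4z + 6z²) ^ (1 / 4)` for `w = 4`.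

Together, the asymptotic rate is at most `-ρ log₂ z + log₂ G` (`asymptoticRate_le`). The stated
bounds come from `z = ρ / (1 - ρ)` for general `w` and for `w = 4`, and, for `w = 3`, from the
optimal `z = ρ / (1 - 3ρ)` where this is less than one and from `z = 1` otherwise.
-/

namespace LDPC

open Finset

variable {n : ℕ}

/-! ### Coset weights -/

/-- The least Hamming weight in the coset `x + D`: the distance of that coset from the identity in
the coset graph of `D`, the Cayley graph of `𝔽₂ⁿ / D` generated by the unit vectors. -/
noncomputable def cosetWeight (D : BinaryCode n) (x : Fin n → ZMod 2) : ℕ :=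
  sInf ((fun d => hammingNorm (x + d)) '' (D : Set (Fin n → ZMod 2)))

lemma exists_hammingNorm_eq_cosetWeight (D : BinaryCode n) (x : Fin n → ZMod 2) :
    ∃ d ∈ D, hammingNorm (x + d) = cosetWeight D x :=
  Nat.sInf_mem (s := (fun d => hammingNorm (x + d)) '' (D : Set (Fin n → ZMod 2)))
    ⟨_, 0, D.zero_mem, rfl⟩

lemma cosetWeight_le {D : BinaryCode n} (x : Fin n → ZMod 2) {d : Fin n → ZMod 2} (hd : d ∈ D) :
    cosetWeight D x ≤ hammingNorm (x + d) :=
  Nat.sInf_le ⟨d, hd, rfl⟩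

lemma hammingNorm_add_le (x y : Fin n → ZMod 2) :
    hammingNorm (x + y) ≤ hammingNorm x + hammingNorm y := by
  have h := hammingDist_triangle x 0 y
  rwa [hammingDist_zero_right, hammingDist_zero_left, hammingDist_eq_hammingNorm,
    show -x = x from funext fun i => ZMod.neg_eq_self_mod_two (x i)] at h

lemma hammingNorm_add_of_disjoint {x y : Fin n → ZMod 2} (h : ∀ i, x i = 0 ∨ y i = 0) :
    hammingNorm (x + y) = hammingNorm x + hammingNorm y := by
  unfold hammingNorm
  rw [← card_union_of_disjoint]
  · congr 1
    ext i
    rcases h i with h | h <;> simp [h]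
  · rw [disjoint_left]
    intro i
    rcases h i with h | h <;> simp [h]

lemma vec_add_self (x : Fin n → ZMod 2) : x + x = 0 := by
  ext i
  exact CharTwo.add_self_eq_zero _

lemma cosetWeight_add_le (D : BinaryCode n) (x u : Fin n → ZMod 2) :
    cosetWeight D (x + u) ≤ cosetWeight D x + hammingNorm u := by
  obtain ⟨d, hd, h⟩ := exists_hammingNorm_eq_cosetWeight D x
  rw [← h]
  refine (cosetWeight_le _ hd).trans ?_
  rw [show x + u + d = (x + d) + u by abel]
  exact hammingNorm_add_le _ _

lemma cosetWeight_le_add (D : BinaryCode n) (x u : Fin n → ZMod 2) :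
    cosetWeight D x ≤ cosetWeight D (x + u) + hammingNorm u := by
  simpa [add_assoc, vec_add_self] using cosetWeight_add_le D (x + u) u

lemma min_le_cosetWeight_sup_span (D : BinaryCode n) (c x : Fin n → ZMod 2) :
    min (cosetWeight D x) (cosetWeight D (x + c)) ≤ cosetWeight (D ⊔ Submodule.span _ {c}) x := by
  obtain ⟨e, he, h⟩ := exists_hammingNorm_eq_cosetWeight (D ⊔ Submodule.span _ {c}) x
  rw [← h]
  obtain ⟨d, hd, f, hf, rfl⟩ := Submodule.mem_sup.1 he
  obtain ⟨a, rfl⟩ := Submodule.mem_span_singleton.1 hf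
  have ha : a = 0 ∨ a = 1 := by clear he h hf; revert a; decide
  rcases ha with rfl | rfl
  · simpa using Or.inl (cosetWeight_le x hd)
  · refine (min_le_right _ _).trans ?_
    rw [show x + (d + (1 : ZMod 2) • c) = x + c + d by rw [one_smul]; abel]
    exact cosetWeight_le _ hd

lemma le_cosetWeight_add_of_disjoint {D : BinaryCode n} {M : Finset (Fin n)}
    (hD : ∀ d ∈ D, ∀ i ∉ M, d i = 0) {x y : Fin n → ZMod 2} (hx : ∀ i ∉ M, x i = 0)
    (hy : ∀ i ∈ M, y i = 0) : cosetWeight D x + hammingNorm y ≤ cosetWeight D (x + y) := by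
  obtain ⟨d, hd, h⟩ := exists_hammingNorm_eq_cosetWeight D (x + y)
  rw [← h, show x + y + d = (x + d) + y by abel, hammingNorm_add_of_disjoint]
  · exact Nat.add_le_add_right (cosetWeight_le x hd) _
  · intro i
    by_cases hi : i ∈ M
    · exact Or.inr (hy i hi)
    · exact Or.inl (by simp [hx i hi, hD d hd i hi])

/-! ### Sums over vectors with prescribed support -/

/-- The vectors of `𝔽₂ⁿ` that vanish outside `M`. -/
def supportedOn (M : Finset (Fin n)) : Finset (Fin n → ZMod 2) :=
  univ.filter fun x => ∀ i ∉ M, x i = 0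

@[simp] lemma mem_supportedOn {M : Finset (Fin n)} {x : Fin n → ZMod 2} :
    x ∈ supportedOn M ↔ ∀ i ∉ M, x i = 0 := by
  simp [supportedOn]

/-- The restriction of `x` to the coordinates in `M`, extended by zero. -/
def restrictTo (M : Finset (Fin n)) (x : Fin n → ZMod 2) : Fin n → ZMod 2 :=
  fun i => if i ∈ M then x i else 0

lemma sum_supportedOn_union {M N : Finset (Fin n)} (h : Disjoint M N)
    (F : (Fin n → ZMod 2) → ℝ) :
    ∑ x ∈ supportedOn (M ∪ N), F x = ∑ g ∈ supportedOn M, ∑ y ∈ supportedOn N, F (g + y) := by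
  rw [← sum_product']
  symm
  refine sum_bij' (fun p _ => p.1 + p.2) (fun x _ => (restrictTo M x, restrictTo N x))
    ?_ ?_ ?_ ?_ ?_
  · rintro ⟨g, y⟩ hp
    simp only [mem_product, mem_supportedOn, mem_union, not_or] at hp ⊢
    intro i hi
    simp [hp.1 i hi.1, hp.2 i hi.2]
  · intro x _
    simp +contextual [restrictTo]
  · rintro ⟨g, y⟩ hp
    simp only [mem_product, mem_supportedOn] at hp
    ext i
    · by_cases hi : i ∈ M
      · simp [restrictTo, hi, hp.2 i (disjoint_left.1 h hi)]
      · simp [restrictTo, hi, hp.1 i hi]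
    · by_cases hi : i ∈ N
      · simp [restrictTo, hi, hp.1 i (disjoint_right.1 h hi)]
      · simp [restrictTo, hi, hp.2 i hi]
  · intro x hx
    rw [mem_supportedOn] at hx
    ext i
    by_cases hi : i ∈ M
    · simp [restrictTo, hi, disjoint_left.1 h hi]
    · by_cases hi' : i ∈ N
      · simp [restrictTo, hi, hi']
      · simp [restrictTo, hi, hi', hx i (by simp [hi, hi'])]
  · simp

lemma sum_supportedOn_hammingNorm (N : Finset (Fin n)) (h : ℕ → ℝ) :
    ∑ y ∈ supportedOn N, h (hammingNorm y) =
      ∑ k ∈ range (N.card + 1), (N.card.choose k : ℝ) * h k := by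
  have key := sum_powerset_apply_card h (x := N)
  simp only [nsmul_eq_mul] at key
  rw [← key]
  refine sum_bij' (fun y _ => univ.filter fun i => y i ≠ 0) (fun T _ i => if i ∈ T then 1 else 0)
    ?_ ?_ ?_ ?_ ?_
  · intro y hy
    rw [mem_supportedOn] at hy
    rw [mem_powerset]
    intro i hi
    by_contra hN
    simp [hy i hN] at hi
  · intro T hT
    rw [mem_powerset] at hT
    rw [mem_supportedOn]
    intro i hi
    simpa using fun h => hi (hT h)
  · intro y _
    ext i
    have : y i = 0 ∨ y i = 1 := by generalize y i = a; revert a; decide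
    rcases this with h | h <;> simp [h]
  · intro T _
    ext i
    simp
  · intro y _
    rfl

lemma sum_supportedOn_add {M : Finset (Fin n)} {u : Fin n → ZMod 2} (hu : u ∈ supportedOn M)
    (F : (Fin n → ZMod 2) → ℝ) :
    ∑ g ∈ supportedOn M, F (g + u) = ∑ g ∈ supportedOn M, F g := by
  rw [mem_supportedOn] at hu
  refine sum_bij' (fun g _ => g + u) (fun g _ => g + u) ?_ ?_ ?_ ?_ ?_
  · intro g hg
    simp only [mem_supportedOn] at hg ⊢
    intro i hi
    simp [hg i hi, hu i hi]
  · intro g hg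
    simp only [mem_supportedOn] at hg ⊢
    intro i hi
    simp [hg i hi, hu i hi]
  · intro g _
    simp [add_assoc, vec_add_self]
  · intro g _
    simp [add_assoc, vec_add_self]
  · simp

/-! ### Growth of the coset weight enumerator -/

/-- `G` bounds the growth per coordinate, at the parameter `z`, of the coset weight enumerator when
words of weight at most `w` are adjoined to a code: `s` is the number of coordinates that the new
word `c` is the first to cover, while `a` and `b` are the weights of two old cosets that `c`
identifies. These differ by at most the number `w - s` of old coordinates in the support of `c`. -/
def IsGrowthBound (w : ℕ) (z G : ℝ) : Prop :=
  ∀ s ≤ w, ∀ a b : ℕ, a ≤ b + (w - s) → b ≤ a + (w - s) →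
    ∑ k ∈ range (s + 1), (s.choose k : ℝ) * z ^ min (a + k) (b + (s - k)) ≤ G ^ s * (z ^ a + z ^ b)

/-- The support of a vector. -/
def vecSupport (c : Fin n → ZMod 2) : Finset (Fin n) := univ.filter fun i => c i ≠ 0

@[simp] lemma mem_vecSupport {c : Fin n → ZMod 2} {i : Fin n} : i ∈ vecSupport c ↔ c i ≠ 0 := by
  simp [vecSupport]

/-- Adjoining a word `c` outside `D` doubles the size of the code and multiplies the sum of
`z ^ cosetWeight` by at most `2 G ^ s`, for `s` newly covered coordinates. -/
lemma sum_pow_cosetWeight_sup_span_le {w : ℕ} {z G : ℝ} (hz : 0 < z) (hz1 : z ≤ 1)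
    (hG : IsGrowthBound w z G) {D : BinaryCode n} {M : Finset (Fin n)}
    (hD : ∀ d ∈ D, ∀ i ∉ M, d i = 0) {c : Fin n → ZMod 2} (hc : hammingNorm c ≤ w) :
    ∑ x ∈ supportedOn (M ∪ (vecSupport c \ M)), z ^ cosetWeight (D ⊔ Submodule.span _ {c}) x ≤
      2 * G ^ (vecSupport c \ M).card * ∑ x ∈ supportedOn M, z ^ cosetWeight D x := by
  set N := vecSupport c \ M with hN
  have hMN : Disjoint M N := disjoint_sdiff
  set u := restrictTo M c
  set v := restrictTo N c
  have hu : u ∈ supportedOn M := by simp +contextual [u, restrictTo]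
  have huv : c = u + v := by
    ext i
    by_cases hi : i ∈ M
    · simp [u, v, restrictTo, hi, hN]
    · by_cases hi' : c i = 0 <;> simp [u, v, restrictTo, hi, hi', hN]
  have hvN : hammingNorm v = N.card := by
    unfold hammingNorm
    congr 1
    ext i
    simp only [v, restrictTo, hN, mem_filter, mem_univ, true_and, mem_sdiff, mem_vecSupport]
    by_cases hi : i ∈ M <;> by_cases hi' : c i = 0 <;> simp [hi, hi']
  have hcuv : hammingNorm c = hammingNorm u + N.card := by
    rw [huv, hammingNorm_add_of_disjoint, hvN]
    intro i
    by_cases hi : i ∈ M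
    · exact Or.inr (by simp [v, restrictTo, hi, hN])
    · exact Or.inl (by simp [u, restrictTo, hi])
  have hvy : ∀ y ∈ supportedOn N, hammingNorm (y + v) = N.card - hammingNorm y := by
    intro y hy
    rw [mem_supportedOn] at hy
    have h1 : v = (y + v) + y := by
      rw [add_comm y v, add_assoc, vec_add_self, add_zero]
    have h2 : hammingNorm v = hammingNorm (y + v) + hammingNorm y := by
      conv_lhs => rw [h1]
      refine hammingNorm_add_of_disjoint fun i => ?_
      by_cases hi : i ∈ N
      · have hci : c i ≠ 0 := by
          simp only [hN, mem_sdiff, mem_vecSupport] at hi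
          exact hi.1
        simp only [v, restrictTo, Pi.add_apply, hi, if_true]
        generalize c i = p at hci ⊢
        generalize y i = q
        revert p q
        decide
      · exact Or.inr (hy i hi)
    omega
  rw [sum_supportedOn_union hMN]
  have inner : ∀ g ∈ supportedOn M,
      ∑ y ∈ supportedOn N, z ^ cosetWeight (D ⊔ Submodule.span _ {c}) (g + y) ≤
        G ^ N.card * (z ^ cosetWeight D g + z ^ cosetWeight D (g + u)) := by
    intro g hg
    have hgu : g + u ∈ supportedOn M := by
      rw [mem_supportedOn] at hg hu ⊢
      intro i hi
      simp [hg i hi, hu i hi]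
    refine le_trans ?_ (hG N.card (by omega) (cosetWeight D g) (cosetWeight D (g + u)) ?_ ?_)
    · rw [← sum_supportedOn_hammingNorm N
        (fun k => z ^ min (cosetWeight D g + k) (cosetWeight D (g + u) + (N.card - k)))]
      refine sum_le_sum fun y hy => pow_le_pow_of_le_one hz.le hz1 ?_
      refine le_trans ?_ (min_le_cosetWeight_sup_span D c (g + y))
      have hyM : ∀ i ∈ M, y i = 0 := fun i hi =>
        mem_supportedOn.1 hy i (disjoint_left.1 hMN hi)
      have hvM : ∀ i ∈ M, (y + v) i = 0 := fun i hi => by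
        simp [hyM i hi, v, restrictTo, disjoint_left.1 hMN hi]
      have h1 := le_cosetWeight_add_of_disjoint hD (mem_supportedOn.1 hg) hyM
      have h2 := le_cosetWeight_add_of_disjoint hD (mem_supportedOn.1 hgu) hvM
      rw [hvy y hy, show g + u + (y + v) = g + y + c by rw [huv]; abel] at h2
      exact min_le_min h1 h2
    · exact (cosetWeight_le_add D g u).trans (by omega)
    · exact (cosetWeight_add_le D g u).trans (by omega)
  refine (sum_le_sum inner).trans (le_of_eq ?_)
  rw [← mul_sum, sum_add_distrib, sum_supportedOn_add hu (fun x => z ^ cosetWeight D x)]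
  ring

lemma natCard_eq_two_pow_finrank (D : BinaryCode n) :
    Nat.card D = 2 ^ Module.finrank (ZMod 2) D := by
  rw [Module.natCard_eq_pow_finrank (K := ZMod 2)]
  simp

lemma two_mul_natCard_le_of_lt {D D' : BinaryCode n} (h : D < D') :
    2 * Nat.card D ≤ Nat.card D' := by
  rw [natCard_eq_two_pow_finrank, natCard_eq_two_pow_finrank, ← pow_succ']
  exact Nat.pow_le_pow_right two_pos (Submodule.finrank_lt_finrank_of_lt h)

/-- The coset weight enumerator of a code generated by words of weight at most `w`, restricted to
the coordinates that these words cover; every coset is counted once for each of its elements. -/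
lemma sum_pow_cosetWeight_span_le {w : ℕ} {z G : ℝ} (hz : 0 < z) (hz1 : z ≤ 1) (hG0 : 0 < G)
    (hG : IsGrowthBound w z G) (S : Finset (Fin n → ZMod 2))
    (hS : ∀ c ∈ S, hammingNorm c ≤ w) :
    (∀ d ∈ Submodule.span (ZMod 2) (S : Set (Fin n → ZMod 2)),
      ∀ i ∉ S.biUnion vecSupport, d i = 0) ∧
    ∑ x ∈ supportedOn (S.biUnion vecSupport),
        z ^ cosetWeight (Submodule.span (ZMod 2) (S : Set (Fin n → ZMod 2))) x ≤
      Nat.card (Submodule.span (ZMod 2) (S : Set (Fin n → ZMod 2))) *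
        G ^ (S.biUnion vecSupport).card := by
  induction S using Finset.induction_on with
  | empty =>
    refine ⟨by simp +contextual, ?_⟩
    have h0 : supportedOn (∅ : Finset (Fin n)) = {0} := by
      ext x
      simp [funext_iff]
    have h1 : cosetWeight (⊥ : BinaryCode n) 0 = 0 :=
      Nat.le_zero.1 (by simpa using cosetWeight_le (D := (⊥ : BinaryCode n)) 0 (zero_mem _))
    simp [h0, h1]
  | insert c S hcS ih =>
    obtain ⟨ih1, ih2⟩ := ih fun d hd => hS d (mem_insert_of_mem hd)
    have hcw := hS c (mem_insert_self c S)
    set D := Submodule.span (ZMod 2) (S : Set (Fin n → ZMod 2)) with hDdef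
    set M := S.biUnion vecSupport with hMdef
    have hspan : Submodule.span (ZMod 2) ((insert c S : Finset (Fin n → ZMod 2)) :
        Set (Fin n → ZMod 2)) = D ⊔ Submodule.span _ {c} := by
      rw [coe_insert, Submodule.span_insert, sup_comm]
    have hM' : (insert c S).biUnion vecSupport = M ∪ (vecSupport c \ M) := by
      rw [biUnion_insert, union_sdiff_self_eq_union, union_comm]
    rw [hspan, hM']
    refine ⟨?_, ?_⟩
    · intro d hd i hi
      simp only [mem_union, mem_sdiff, mem_vecSupport, not_or, not_and, not_not] at hi
      obtain ⟨e, he, f, hf, rfl⟩ := Submodule.mem_sup.1 hd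
      obtain ⟨a, rfl⟩ := Submodule.mem_span_singleton.1 hf
      have hci : c i = 0 := by
        by_contra h
        exact hi.1 (hi.2 h)
      simp [ih1 e he i hi.1, hci]
    · by_cases hc : c ∈ D
      · have h1 : D ⊔ Submodule.span _ {c} = D :=
          sup_eq_left.2 ((Submodule.span_singleton_le_iff_mem _ _).2 hc)
        have h2 : M ∪ (vecSupport c \ M) = M := by
          rw [union_sdiff_self_eq_union, union_eq_left]
          intro i hi
          by_contra h
          exact (mem_vecSupport.1 hi) (ih1 c hc i h)
        rw [h1, h2]
        exact ih2
      · refine (sum_pow_cosetWeight_sup_span_le hz hz1 hG ih1 hcw).trans ?_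
        have hlt : D < D ⊔ Submodule.span _ {c} :=
          left_lt_sup.2 fun h => hc ((Submodule.span_singleton_le_iff_mem _ _).1 h)
        have hcard : (2 * Nat.card D : ℝ) ≤ Nat.card ↥(D ⊔ Submodule.span _ {c}) := by
          exact_mod_cast two_mul_natCard_le_of_lt hlt
        rw [card_union_of_disjoint disjoint_sdiff, pow_add]
        set s := (vecSupport c \ M).card
        calc _ ≤ 2 * G ^ s * (Nat.card D * G ^ M.card) := by gcongr
          _ = (2 * Nat.card D) * (G ^ M.card * G ^ s) := by ring
          _ ≤ _ := by gcongr

/-! ### Admissible growth rates -/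

/-- Since `a` and `b` play symmetric roles, only `b = a + j` with `j ≤ w - s` has to be examined,
and the common factor `z ^ a` cancels. -/
lemma isGrowthBound_of_forall {w : ℕ} {z G : ℝ} (hz : 0 < z)
    (h : ∀ s ≤ w, ∀ j ≤ w - s,
      ∑ k ∈ range (s + 1), (s.choose k : ℝ) * z ^ min k (j + (s - k)) ≤ G ^ s * (1 + z ^ j)) :
    IsGrowthBound w z G := by
  have key : ∀ s ≤ w, ∀ a j : ℕ, j ≤ w - s →
      ∑ k ∈ range (s + 1), (s.choose k : ℝ) * z ^ min (a + k) (a + j + (s - k)) ≤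
        G ^ s * (z ^ a + z ^ (a + j)) := by
    intro s hs a j hj
    have h1 := mul_le_mul_of_nonneg_left (h s hs j hj) (pow_pos hz a).le
    calc _ = z ^ a * ∑ k ∈ range (s + 1), (s.choose k : ℝ) * z ^ min k (j + (s - k)) := by
          rw [mul_sum]
          refine sum_congr rfl fun k _ => ?_
          rw [add_assoc, Nat.add_min_add_left, pow_add]
          ring
      _ ≤ _ := h1
      _ = _ := by rw [pow_add]; ring
  intro s hs a b hab hba
  rcases le_total a b with hle | hle
  · obtain ⟨j, rfl⟩ := Nat.exists_eq_add_of_le hle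
    exact key s hs a j (by omega)
  · obtain ⟨j, rfl⟩ := Nat.exists_eq_add_of_le hle
    rw [add_comm (z ^ (b + j))]
    refine le_trans (le_of_eq ?_) (key s hs b j (by omega))
    rw [← sum_range_reflect]
    refine sum_congr rfl fun k hk => ?_
    rw [mem_range] at hk
    rw [show s + 1 - 1 - k = s - k by omega, Nat.choose_symm (by omega), min_comm,
      show s - (s - k) = k by omega]

/-- The growth rate valid for every `w`: since the two exponents in the minimum differ by at most
`w`, the minimum satisfies `z ^ min p q ≤ (z ^ p + z ^ q) / (1 + z ^ w)`. -/
lemma isGrowthBound_general {w : ℕ} {z : ℝ} (hz : 0 < z) (hz1 : z ≤ 1) :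
    IsGrowthBound w z ((1 + z) / (1 + z ^ w) ^ (1 / (w : ℝ))) := by
  refine isGrowthBound_of_forall hz fun s hs j hj => ?_
  have hzw : 0 < z ^ w := pow_pos hz w
  have hmin : ∀ k ∈ range (s + 1), z ^ min k (j + (s - k)) * (1 + z ^ w) ≤
      z ^ k + z ^ (j + (s - k)) := by
    intro k hk
    rw [mem_range] at hk
    rw [mul_add, mul_one, ← pow_add]
    rcases le_total k (j + (s - k)) with h | h
    · rw [min_eq_left h]
      gcongr ?_ + ?_
      · rfl
      · exact pow_le_pow_of_le_one hz.le hz1 (by omega)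
    · rw [min_eq_right h, add_comm]
      gcongr ?_ + ?_
      · exact pow_le_pow_of_le_one hz.le hz1 (by omega)
      · rfl
  have hsum : (∑ k ∈ range (s + 1), (s.choose k : ℝ) * z ^ min k (j + (s - k))) * (1 + z ^ w) ≤
      (1 + z) ^ s * (1 + z ^ j) := by
    have e1 : ∑ k ∈ range (s + 1), (s.choose k : ℝ) * z ^ k = (1 + z) ^ s := by
      rw [add_comm 1 z, add_pow]
      refine sum_congr rfl fun k _ => ?_
      simp [mul_comm]
    have e2 : ∑ k ∈ range (s + 1), (s.choose k : ℝ) * z ^ (s - k) = (1 + z) ^ s := by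
      rw [add_pow]
      refine sum_congr rfl fun k _ => ?_
      simp [mul_comm]
    calc _ = ∑ k ∈ range (s + 1), (s.choose k : ℝ) * (z ^ min k (j + (s - k)) * (1 + z ^ w)) := by
          rw [sum_mul]
          exact sum_congr rfl fun k _ => by ring
      _ ≤ ∑ k ∈ range (s + 1), (s.choose k : ℝ) * (z ^ k + z ^ (j + (s - k))) :=
          sum_le_sum fun k hk => mul_le_mul_of_nonneg_left (hmin k hk) (Nat.cast_nonneg _)
      _ = ∑ k ∈ range (s + 1), (s.choose k : ℝ) * z ^ k +
            z ^ j * ∑ k ∈ range (s + 1), (s.choose k : ℝ) * z ^ (s - k) := by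
          rw [mul_sum, ← sum_add_distrib]
          exact sum_congr rfl fun k _ => by rw [pow_add]; ring
      _ = _ := by rw [e1, e2]; ring
  have hroot : ((1 + z ^ w) ^ (1 / (w : ℝ))) ^ s ≤ 1 + z ^ w := by
    rw [← Real.rpow_natCast, ← Real.rpow_mul (by positivity)]
    calc (1 + z ^ w) ^ (1 / (w : ℝ) * s) ≤ (1 + z ^ w) ^ (1 : ℝ) := by
          refine Real.rpow_le_rpow_of_exponent_le (by linarith) ?_
          rw [one_div_mul_eq_div]
          exact div_le_one_of_le₀ (by exact_mod_cast hs) (Nat.cast_nonneg _)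
      _ = _ := Real.rpow_one _
  rw [div_pow, div_mul_eq_mul_div, le_div_iff₀ (by positivity)]
  refine le_trans ?_ hsum
  exact mul_le_mul_of_nonneg_left hroot (sum_nonneg fun k _ => by positivity)

/-- A word of weight at most three that covers `s` new coordinates multiplies the coset weight
enumerator by at most `1`, `(1 + z) / (1 + z²)`, `(1 + 3z) / (1 + z)` or `1 + 3z`, for
`s = 0, 1, 2, 3`; each of these is at most `(1 + 3z) ^ (s / 3)`. -/
lemma isGrowthBound_three {z G : ℝ} (hz : 0 < z) (hz1 : z ≤ 1) (hG : 0 < G)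
    (hG3 : G ^ 3 = 1 + 3 * z) : IsGrowthBound 3 z G := by
  have h1 : 1 ≤ G := by
    rw [← one_le_pow_iff_of_nonneg hG.le three_ne_zero]
    linarith
  have hG1 : 1 + z ≤ G * (1 + z ^ 2) := by
    refine le_of_pow_le_pow_left₀ three_ne_zero (by positivity) ?_
    rw [mul_pow, hG3]
    have : 0 < z ^ 3 := by positivity
    have : 0 < z ^ 4 := by positivity
    have : 0 < z ^ 5 := by positivity
    have : 0 < z ^ 6 := by positivity
    have : 0 < z ^ 7 := by positivity
    nlinarith
  have hG2 : 1 + 3 * z ≤ G ^ 2 * (1 + z) := by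
    refine le_of_pow_le_pow_left₀ three_ne_zero (by positivity) ?_
    rw [mul_pow, ← pow_mul, mul_comm 2 3, pow_mul, hG3]
    have h : 0 ≤ (1 + 3 * z) ^ 2 * (3 * z ^ 2 + z ^ 3) := by positivity
    nlinarith
  have hG2' : 1 + z ≤ G ^ 2 := by
    have h : (1 + z) * (1 + z) ≤ G ^ 2 * (1 + z) := by nlinarith
    exact le_of_mul_le_mul_right h (by linarith)
  refine isGrowthBound_of_forall hz fun s hs j hj => ?_
  interval_cases s <;> interval_cases j <;>
    norm_num [sum_range_succ, Nat.choose] <;> nlinarith [pow_pos hz 2, pow_pos hz 3]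

/-- A word of weight at most four that covers a single new coordinate multiplies the coset weight
enumerator by up to `(1 + z) / (1 + z³)`, the worst factor per coordinate for small `z`. Its fourth
power is `1 + 4z + 6z² + O(z⁴)`, whence the coefficient `6`. -/
lemma isGrowthBound_four {z G : ℝ} (hz : 0 < z) (hz1 : z ≤ 1) (hG : 0 < G)
    (hG4 : G ^ 4 = 1 + 4 * z + 6 * z ^ 2) : IsGrowthBound 4 z G := by
  have h1 : 1 ≤ G := by
    rw [← one_le_pow_iff_of_nonneg hG.le four_ne_zero]
    nlinarith
  have hG1 : 1 + z ≤ G * (1 + z ^ 3) := by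
    refine le_of_pow_le_pow_left₀ four_ne_zero (by positivity) ?_
    rw [mul_pow, hG4]
    have h : 1 + 4 * z ^ 3 ≤ (1 + z ^ 3) ^ 4 := by
      have : 0 ≤ 6 * z ^ 6 + 4 * z ^ 9 + z ^ 12 := by positivity
      nlinarith
    have h' : (1 + z) ^ 4 ≤ (1 + 4 * z + 6 * z ^ 2) * (1 + 4 * z ^ 3) := by
      have : 0 ≤ 15 * z ^ 4 + 24 * z ^ 5 := by positivity
      nlinarith
    exact h'.trans (mul_le_mul_of_nonneg_left h (by positivity))
  have hG1' : 1 + z ≤ G * (1 + z ^ 2) :=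
    hG1.trans (mul_le_mul_of_nonneg_left (by nlinarith [pow_pos hz 2]) hG.le)
  have hG2 : (1 + z) ^ 2 ≤ G ^ 2 * (1 + z ^ 2) := by
    refine le_of_pow_le_pow_left₀ two_ne_zero (by positivity) ?_
    rw [mul_pow, ← pow_mul G, hG4]
    have : 0 ≤ 2 * z ^ 2 + 4 * z ^ 3 + 12 * z ^ 4 + 4 * z ^ 5 + 6 * z ^ 6 := by positivity
    nlinarith
  have hG2' : 1 + 3 * z ≤ G ^ 2 * (1 + z) := by
    refine le_of_pow_le_pow_left₀ two_ne_zero (by positivity) ?_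
    rw [mul_pow, ← pow_mul, hG4]
    have : 0 ≤ 2 * z + 6 * z ^ 2 + 16 * z ^ 3 + 6 * z ^ 4 := by positivity
    nlinarith
  have hG2'' : 1 + z ≤ G ^ 2 := by
    have h : (1 + z) * (1 + z) ≤ G ^ 2 * (1 + z) := by nlinarith
    exact le_of_mul_le_mul_right h (by linarith)
  have hG3 : 1 + 3 * z ≤ G ^ 3 := by
    refine le_of_pow_le_pow_left₀ four_ne_zero (by positivity) ?_
    rw [← pow_mul, mul_comm 3 4, pow_mul, hG4]
    have : 0 ≤ 12 * z ^ 2 + 100 * z ^ 3 + 315 * z ^ 4 + 432 * z ^ 5 + 216 * z ^ 6 := by positivity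
    nlinarith
  refine isGrowthBound_of_forall hz fun s hs j hj => ?_
  interval_cases s <;> interval_cases j <;>
    norm_num [sum_range_succ, Nat.choose] <;> nlinarith [pow_pos hz 2, pow_pos hz 3]

/-! ### Fourier analysis on `𝔽₂ⁿ` -/

/-- The nontrivial additive character of `𝔽₂`, with values `±1` in `ℝ`. -/
def signChar (a : ZMod 2) : ℝ := if a = 0 then 1 else -1

@[simp] lemma signChar_zero : signChar 0 = 1 := by simp [signChar]

lemma signChar_add (a b : ZMod 2) : signChar (a + b) = signChar a * signChar b := by
  have ha : a = 0 ∨ a = 1 := by revert a; decide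
  have hb : b = 0 ∨ b = 1 := by revert b; decide
  have h2 : (1 : ZMod 2) + 1 = 0 := by decide
  rcases ha with rfl | rfl <;> rcases hb with rfl | rfl <;> simp [signChar, h2]

lemma signChar_of_ne_zero {a : ZMod 2} (h : a ≠ 0) : signChar a = -1 := by simp [signChar, h]

lemma sum_signChar_dotProduct (v : Fin n → ZMod 2) :
    ∑ y : Fin n → ZMod 2, signChar (y ⬝ᵥ v) = if v = 0 then 2 ^ n else 0 := by
  split_ifs with hv
  · simp [hv]
  · obtain ⟨i, hi⟩ := Function.ne_iff.1 hv
    have h : ∑ y : Fin n → ZMod 2, signChar (y ⬝ᵥ v) =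
        ∑ y : Fin n → ZMod 2, -signChar (y ⬝ᵥ v) := by
      rw [← Equiv.sum_comp (Equiv.addRight (Pi.single i (1 : ZMod 2)))
        (fun y => signChar (y ⬝ᵥ v))]
      refine sum_congr rfl fun y _ => ?_
      rw [Equiv.coe_addRight, add_dotProduct, signChar_add, single_dotProduct, one_mul,
        signChar_of_ne_zero hi, mul_neg_one]
    rw [sum_neg_distrib] at h
    linarith

/-- The (unnormalized) Fourier transform of a real function on `𝔽₂ⁿ`, indexed by the characters
`x ↦ (-1) ^ (y ⬝ x)`. -/
noncomputable def walshTransform (f : (Fin n → ZMod 2) → ℝ) (y : Fin n → ZMod 2) : ℝ :=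
  ∑ x, f x * signChar (y ⬝ᵥ x)

lemma walshTransform_zero (f : (Fin n → ZMod 2) → ℝ) : walshTransform f 0 = ∑ x, f x := by
  simp [walshTransform]

lemma sum_walshTransform_sq_mul_signChar (f : (Fin n → ZMod 2) → ℝ) (a : Fin n → ZMod 2) :
    ∑ y, walshTransform f y ^ 2 * signChar (y ⬝ᵥ a) = 2 ^ n * ∑ x, f x * f (x + a) := by
  have h1 : ∀ y, walshTransform f y ^ 2 * signChar (y ⬝ᵥ a) =
      ∑ x, ∑ x', f x * f x' * signChar (y ⬝ᵥ (x + x' + a)) := by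
    intro y
    rw [sq, walshTransform, sum_mul_sum, sum_mul]
    refine sum_congr rfl fun x _ => ?_
    rw [sum_mul]
    refine sum_congr rfl fun x' _ => ?_
    rw [dotProduct_add, dotProduct_add, signChar_add, signChar_add]
    ring
  simp_rw [h1]
  rw [sum_comm, mul_sum]
  refine sum_congr rfl fun x _ => ?_
  rw [sum_comm]
  simp_rw [← mul_sum, sum_signChar_dotProduct]
  rw [sum_eq_single (x + a)]
  · rw [if_pos (by rw [show x + (x + a) + a = (x + x) + (a + a) by abel, vec_add_self,
      vec_add_self, add_zero])]
    ring
  · intro x' _ hx'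
    rw [if_neg, mul_zero]
    intro h
    apply hx'
    calc x' = x' + (x + x) + (a + a) := by rw [vec_add_self, vec_add_self, add_zero, add_zero]
      _ = (x + x' + a) + (x + a) := by abel
      _ = x + a := by rw [h, zero_add]
  · simp

/-- Applied to all `d` in a code `D`: a `D`-invariant function has its Fourier transform
supported on the dual code of `D`. -/
lemma walshTransform_eq_zero_of_invariant {f : (Fin n → ZMod 2) → ℝ} {d : Fin n → ZMod 2}
    (hf : ∀ x, f (x + d) = f x) {y : Fin n → ZMod 2} (hy : y ⬝ᵥ d ≠ 0) :
    walshTransform f y = 0 := by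
  have h : walshTransform f y = -walshTransform f y := by
    conv_lhs => rw [walshTransform, ← Equiv.sum_comp (Equiv.addRight d)]
    rw [walshTransform, ← sum_neg_distrib]
    refine sum_congr rfl fun x _ => ?_
    rw [Equiv.coe_addRight, hf, dotProduct_add, signChar_add, signChar_of_ne_zero hy]
    ring
  linarith

lemma sum_signChar_apply (y : Fin n → ZMod 2) :
    ∑ i, signChar (y i) = (n : ℝ) - 2 * hammingNorm y := by
  have h : ∀ i, signChar (y i) = 1 - 2 * (if y i ≠ 0 then 1 else 0) := by
    intro i
    by_cases hi : y i = 0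
    · simp [hi]
    · rw [signChar_of_ne_zero hi]
      simp [hi]
      norm_num
  simp_rw [h]
  rw [sum_sub_distrib, ← mul_sum, sum_boole]
  simp [hammingNorm]

/-! ### The spectral bound -/

/-- The spectral gap of the coset graph: the adjacency operator has the eigenvalue `n - 2|y|` at
the character of `y ∈ C`, and `|y| ≥ Δ` for `y ≠ 0`. -/
lemma sum_mul_neighbors_le {C : BinaryCode n} {Δ : ℝ}
    (hC : ∀ y ∈ C, y ≠ 0 → Δ ≤ hammingNorm y) {f : (Fin n → ZMod 2) → ℝ}
    (hf : ∀ y ∉ C, walshTransform f y = 0) :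
    2 ^ n * ∑ x, f x * ∑ i, f (x + Pi.single i 1) ≤
      (n - 2 * Δ) * (2 ^ n * ∑ x, f x ^ 2) + 2 * Δ * (∑ x, f x) ^ 2 := by
  have h1 : 2 ^ n * ∑ x, f x * ∑ i, f (x + Pi.single i 1) =
      ∑ y, walshTransform f y ^ 2 * ((n : ℝ) - 2 * hammingNorm y) := by
    simp_rw [← sum_signChar_apply, mul_sum]
    rw [sum_comm, sum_comm (s := univ (α := Fin n → ZMod 2)) (t := univ (α := Fin n))]
    refine sum_congr rfl fun i _ => ?_
    have := sum_walshTransform_sq_mul_signChar f (Pi.single i 1)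
    simp only [dotProduct_single, mul_one] at this
    rw [this, mul_sum]
  have h2 : 2 ^ n * ∑ x, f x ^ 2 = ∑ y, walshTransform f y ^ 2 := by
    have := sum_walshTransform_sq_mul_signChar f 0
    simpa [sq] using this.symm
  rw [h1, h2, ← walshTransform_zero f, mul_sum]
  have h3 : 2 * Δ * walshTransform f 0 ^ 2 =
      ∑ y, if y = 0 then 2 * Δ * walshTransform f y ^ 2 else 0 := by
    simp
  rw [h3, ← sum_add_distrib]
  refine sum_le_sum fun y _ => ?_
  by_cases hy : y = 0
  · subst hy
    simp only [hammingNorm_zero, if_true]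
    apply le_of_eq
    push_cast
    ring
  · rw [if_neg hy, add_zero]
    by_cases hyC : y ∈ C
    · nlinarith [hC y hyC hy, sq_nonneg (walshTransform f y)]
    · simp [hf y hyC]

/-- A nonnegative function whose sum over neighbours dominates `μ` times its value, with `μ` above
the second eigenvalue `n - 2Δ` by at least one, cannot be supported on a small set. -/
lemma two_pow_le_of_subharmonic {C : BinaryCode n} {Δ μ : ℝ} (hΔ : 0 ≤ Δ)
    (hC : ∀ y ∈ C, y ≠ 0 → Δ ≤ hammingNorm y) {f : (Fin n → ZMod 2) → ℝ}
    (hf : ∀ y ∉ C, walshTransform f y = 0) (hf0 : ∀ x, 0 ≤ f x) (hne : ∃ x, f x ≠ 0)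
    (hμ : n - 2 * Δ + 1 ≤ μ) (hsub : ∀ x, μ * f x ≤ ∑ i, f (x + Pi.single i 1))
    (B : Finset (Fin n → ZMod 2)) (hB : ∀ x ∉ B, f x = 0) :
    (2 : ℝ) ^ n ≤ 2 * Δ * B.card := by
  have hS : 0 < ∑ x, f x ^ 2 := by
    obtain ⟨x, hx⟩ := hne
    exact sum_pos' (fun _ _ => sq_nonneg _) ⟨x, mem_univ x, by positivity⟩
  have h1 : μ * ∑ x, f x ^ 2 ≤ ∑ x, f x * ∑ i, f (x + Pi.single i 1) := by
    rw [mul_sum]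
    refine sum_le_sum fun x _ => ?_
    nlinarith [hsub x, hf0 x]
  have h2 : (∑ x, f x) ^ 2 ≤ B.card * ∑ x, f x ^ 2 := by
    have e1 : ∑ x, f x = ∑ x ∈ B, f x :=
      (sum_subset (subset_univ B) fun x _ hx => hB x hx).symm
    have e2 : ∑ x, f x ^ 2 = ∑ x ∈ B, f x ^ 2 :=
      (sum_subset (subset_univ B) fun x _ hx => by simp [hB x hx]).symm
    rw [e1, e2]
    exact sq_sum_le_card_mul_sum_sq
  have h3 := sum_mul_neighbors_le hC hf
  have h4 : 2 ^ n * ((n - 2 * Δ + 1) * ∑ x, f x ^ 2) ≤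
      2 ^ n * ∑ x, f x * ∑ i, f (x + Pi.single i 1) := by
    gcongr
    exact (mul_le_mul_of_nonneg_right hμ hS.le).trans h1
  have h5 : 2 * Δ * (∑ x, f x) ^ 2 ≤ 2 * Δ * (B.card * ∑ x, f x ^ 2) := by gcongr
  refine le_of_mul_le_mul_right ?_ hS
  nlinarith

lemma hammingNorm_add_single (x : Fin n → ZMod 2) (i : Fin n) :
    hammingNorm (x + Pi.single i 1) =
      if x i = 0 then hammingNorm x + 1 else hammingNorm x - 1 := by
  have key : ∀ z : Fin n → ZMod 2, z i = 0 →
      hammingNorm (z + Pi.single i 1) = hammingNorm z + 1 := by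
    intro z hz
    rw [hammingNorm_add_of_disjoint]
    · congr 1
      unfold hammingNorm
      rw [card_eq_one]
      refine ⟨i, ?_⟩
      ext j
      by_cases hj : j = i
      · subst hj; simp
      · simp [hj]
    · intro j
      by_cases hj : j = i
      · subst hj; exact Or.inl hz
      · exact Or.inr (by simp [hj])
  split_ifs with h
  · exact key x h
  · have hx : x i = 1 := by
      generalize x i = a at h
      revert a
      decide
    have h1 := key (x + Pi.single i 1) (by
      simp only [Pi.add_apply, Pi.single_eq_same, hx]
      decide)
    rw [add_assoc, vec_add_self, add_zero] at h1
    omega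

/-- The adjacency operator of the Hamming cube on a radial function. -/
lemma sum_radial_add_single (a : ℕ → ℝ) (x : Fin n → ZMod 2) :
    ∑ i, a (hammingNorm (x + Pi.single i 1)) =
      hammingNorm x * a (hammingNorm x - 1) +
        ((n : ℝ) - hammingNorm x) * a (hammingNorm x + 1) := by
  have h : ∀ i, a (hammingNorm (x + Pi.single i 1)) = a (hammingNorm x + 1) +
      (a (hammingNorm x - 1) - a (hammingNorm x + 1)) * (if x i ≠ 0 then 1 else 0) := by
    intro i
    rw [hammingNorm_add_single]
    by_cases h1 : x i = 0
    · simp [h1]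
    · simp [h1]
  simp_rw [h]
  rw [sum_add_distrib, ← mul_sum, sum_boole]
  simp only [sum_const, card_univ, Fintype.card_fin, nsmul_eq_mul]
  rw [show (((univ.filter fun i => x i ≠ 0).card : ℕ) : ℝ) = hammingNorm x from rfl]
  ring

/-- A radial profile concentrated on the levels strictly between `k₀` and `k₀ + M`: a parabola in
the level, tilted by a geometric factor. Subtraction is truncated, so it vanishes elsewhere. -/
noncomputable def bandProfile (q : ℝ) (k₀ M k : ℕ) : ℝ :=
  q ^ k * ((k - k₀ : ℕ) : ℝ) * ((M - (k - k₀) : ℕ) : ℝ)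

lemma bandProfile_nonneg {q : ℝ} (hq : 0 ≤ q) (k₀ M k : ℕ) : 0 ≤ bandProfile q k₀ M k := by
  unfold bandProfile
  positivity

/-- The profile is an approximate eigenfunction of the adjacency operator of the Hamming cube. The
tilt `q = √(k₀ / m)` balances the rates of moving down (at least `k₀`) and up (at least
`m = n - k₀ - M`); the discrete second derivative of the parabola costs the factor
`1 - 1 / (M - 1)`. -/
lemma bandProfile_subharmonic {k₀ M m : ℕ} (hM : 2 ≤ M) (hk₀ : 0 < k₀) (hm : 0 < m)
    (hn : k₀ + M + m ≤ n) {k : ℕ} (hk : k ≤ n) :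
    2 * √((k₀ : ℝ) * m) * (1 - 1 / ((M : ℝ) - 1)) * bandProfile √((k₀ : ℝ) / m) k₀ M k ≤
      k * bandProfile √((k₀ : ℝ) / m) k₀ M (k - 1) +
        ((n : ℝ) - k) * bandProfile √((k₀ : ℝ) / m) k₀ M (k + 1) := by
  set q := √((k₀ : ℝ) / m) with hq
  have hk₀' : (0 : ℝ) < k₀ := by exact_mod_cast hk₀
  have hm' : (0 : ℝ) < m := by exact_mod_cast hm
  have hq0 : 0 < q := Real.sqrt_pos.2 (by positivity)
  have hkn : (k : ℝ) ≤ n := by exact_mod_cast hk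
  by_cases hband : k₀ < k ∧ k < k₀ + M
  · obtain ⟨hb1, hb2⟩ := hband
    obtain ⟨i, rfl⟩ : ∃ i, k = k₀ + (i + 1) := ⟨k - k₀ - 1, by omega⟩
    obtain ⟨l, rfl⟩ : ∃ l, M = i + 1 + (l + 1) := ⟨M - (i + 1) - 1, by omega⟩
    set s := √((k₀ : ℝ) * m) with hs
    have e1 : (k₀ : ℝ) = s * q := by
      rw [hs, hq, ← Real.sqrt_mul (by positivity),
        show (k₀ : ℝ) * m * (k₀ / m) = k₀ ^ 2 by field_simp, Real.sqrt_sq hk₀'.le]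
    have e2 : (m : ℝ) * q = s := by
      rw [hs, hq, show (k₀ : ℝ) * m = m ^ 2 * (k₀ / m) by field_simp,
        Real.sqrt_mul (by positivity), Real.sqrt_sq hm'.le]
    have hmn : (m : ℝ) ≤ n - (k₀ + (i + 1) : ℕ) := by
      have : m + (k₀ + (i + 1)) ≤ n := by omega
      rw [le_sub_iff_add_le]
      exact_mod_cast this
    have b0 : bandProfile q k₀ (i + 1 + (l + 1)) (k₀ + (i + 1)) =
        q ^ (k₀ + i) * q * (i + 1) * (l + 1) := by
      unfold bandProfile
      rw [show k₀ + (i + 1) - k₀ = i + 1 by omega,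
        show i + 1 + (l + 1) - (i + 1) = l + 1 by omega]
      push_cast
      ring
    have b1 : bandProfile q k₀ (i + 1 + (l + 1)) (k₀ + (i + 1) - 1) =
        q ^ (k₀ + i) * i * (l + 2) := by
      unfold bandProfile
      rw [show k₀ + (i + 1) - 1 = k₀ + i by omega, show k₀ + i - k₀ = i by omega,
        show i + 1 + (l + 1) - i = l + 2 by omega]
      push_cast
      ring
    have b2 : bandProfile q k₀ (i + 1 + (l + 1)) (k₀ + (i + 1) + 1) =
        q ^ (k₀ + i) * q ^ 2 * (i + 2) * l := by
      unfold bandProfile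
      rw [show k₀ + (i + 1) + 1 - k₀ = i + 2 by omega,
        show i + 1 + (l + 1) - (i + 2) = l by omega]
      push_cast
      ring
    have hs0 : 0 ≤ s := Real.sqrt_nonneg _
    rw [b0, b1, b2]
    have hP : 0 < q ^ (k₀ + i) := by positivity
    have hil : (0 : ℝ) < i + l + 1 := by positivity
    calc 2 * s * (1 - 1 / (((i + 1 + (l + 1) : ℕ) : ℝ) - 1)) *
          (q ^ (k₀ + i) * q * (i + 1) * (l + 1))
        = q ^ (k₀ + i) * q * s * (2 * (i + 1) * (l + 1) * (1 - 1 / ((i : ℝ) + l + 1))) := by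
          push_cast
          rw [show (i : ℝ) + 1 + (l + 1) - 1 = i + l + 1 by ring]
          ring
      _ ≤ q ^ (k₀ + i) * q * s * (i * (l + 2) + (i + 2) * l) := by
          gcongr
          rw [mul_sub, mul_one, mul_one_div, sub_le_iff_le_add, ← sub_le_iff_le_add',
            le_div_iff₀ hil]
          have : (0 : ℝ) ≤ i * l := by positivity
          nlinarith
      _ = s * q * (q ^ (k₀ + i) * i * (l + 2)) +
            m * q * (q ^ (k₀ + i) * q * (i + 2) * l) := by rw [e2]; ring
      _ = k₀ * (q ^ (k₀ + i) * i * (l + 2)) + m * (q ^ (k₀ + i) * q ^ 2 * (i + 2) * l) := by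
          rw [← e1]; ring
      _ ≤ _ := by
          gcongr
  · have h0 : bandProfile q k₀ M k = 0 := by
      unfold bandProfile
      rcases not_and_or.1 hband with h | h
      · simp [show k - k₀ = 0 by omega]
      · simp [show M - (k - k₀) = 0 by omega]
    rw [h0, mul_zero]
    have h1 := bandProfile_nonneg hq0.le k₀ M (k - 1)
    have h2 := bandProfile_nonneg hq0.le k₀ M (k + 1)
    have h3 : (0 : ℝ) ≤ n - k := by linarith
    positivity

/-- If the dual code of `D` has minimum distance at least `Δ`, then the ball of radius `k₀ + M` in
the coset graph of `D` is large: it contains at least the fraction `1 / (2Δ)` of the vertices. -/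
lemma two_pow_le_card_cosetWeight_le {C D : BinaryCode n} {Δ : ℝ} (hΔ : 0 ≤ Δ)
    (hC : ∀ y ∈ C, y ≠ 0 → Δ ≤ hammingNorm y) (hCD : ∀ y ∉ C, ∃ d ∈ D, y ⬝ᵥ d ≠ 0)
    {k₀ M m : ℕ} (hM : 2 ≤ M) (hk₀ : 0 < k₀) (hm : 0 < m) (hn : k₀ + M + m ≤ n)
    (hμ : n - 2 * Δ + 1 ≤ 2 * √((k₀ : ℝ) * m) * (1 - 1 / ((M : ℝ) - 1))) :
    (2 : ℝ) ^ n ≤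
      2 * Δ * (univ.filter fun x : Fin n → ZMod 2 => cosetWeight D x ≤ k₀ + M).card := by
  classical
  set q := √((k₀ : ℝ) / m) with hq
  have hq0 : 0 < q := by
    have hk₀' : (0 : ℝ) < k₀ := by exact_mod_cast hk₀
    have hm' : (0 : ℝ) < m := by exact_mod_cast hm
    exact Real.sqrt_pos.2 (by positivity)
  set a := bandProfile q k₀ M with ha
  have ha0 : ∀ k, 0 ≤ a k := fun k => bandProfile_nonneg hq0.le k₀ M k
  -- The pushforward of the radial function to `𝔽₂ⁿ / D`, as a `D`-invariant function.
  set f : (Fin n → ZMod 2) → ℝ := fun x =>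
    ∑ d : D, a (hammingNorm (x + (d : Fin n → ZMod 2))) with hf
  refine two_pow_le_of_subharmonic hΔ hC (f := f) ?_ ?_ ?_ hμ ?_ _ ?_
  · intro y hy
    obtain ⟨d, hd, hyd⟩ := hCD y hy
    refine walshTransform_eq_zero_of_invariant (d := d) (fun x => ?_) hyd
    simp only [hf]
    rw [← Equiv.sum_comp (Equiv.addLeft (⟨d, hd⟩ : D))
      (fun e : D => a (hammingNorm (x + (e : Fin n → ZMod 2))))]
    refine sum_congr rfl fun e _ => ?_
    simp [add_assoc]
  · exact fun x => sum_nonneg fun d _ => ha0 _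
  · obtain ⟨T, -, hT⟩ := exists_subset_card_eq
      (show k₀ + 1 ≤ (univ : Finset (Fin n)).card by rw [card_univ, Fintype.card_fin]; omega)
    refine ⟨fun i => if i ∈ T then 1 else 0, ne_of_gt ?_⟩
    refine sum_pos' (fun d _ => ha0 _) ⟨0, mem_univ _, ?_⟩
    have : hammingNorm ((fun i => if i ∈ T then 1 else 0) + ((0 : D) : Fin n → ZMod 2)) =
        k₀ + 1 := by
      simp [hammingNorm, hT]
    rw [this, ha, bandProfile, show k₀ + 1 - k₀ = 1 by omega]
    have : (0 : ℝ) < ((M - 1 : ℕ) : ℝ) := by exact_mod_cast (by omega : 0 < M - 1)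
    positivity
  · intro x
    simp only [hf]
    rw [sum_comm, mul_sum]
    refine sum_le_sum fun d _ => ?_
    have h := sum_radial_add_single a (x + (d : Fin n → ZMod 2))
    simp_rw [show ∀ i, x + Pi.single i 1 + (d : Fin n → ZMod 2) =
      x + (d : Fin n → ZMod 2) + Pi.single i 1 from fun i => add_right_comm _ _ _]
    rw [h]
    exact bandProfile_subharmonic hM hk₀ hm hn
      (hammingNorm_le_card_fintype.trans (by simp))
  · intro x hx
    simp only [mem_filter, mem_univ, true_and, not_le] at hx
    refine sum_eq_zero fun d _ => ?_
    have h := hx.trans_le (cosetWeight_le x d.2)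
    simp [ha, bandProfile, show M - (hammingNorm (x + (d : Fin n → ZMod 2)) - k₀) = 0 by omega]

/-! ### Bounds on the rate -/

lemma natCard_mul_natCard_span_rows_le {m : ℕ} {C : BinaryCode n}
    {A : Matrix (Fin m) (Fin n) (ZMod 2)} (hA : ∀ x, x ∈ C ↔ A.mulVec x = 0) :
    Nat.card C * Nat.card (Submodule.span (ZMod 2) (Set.range A)) ≤ 2 ^ n := by
  have hC : C = LinearMap.ker A.mulVecLin := by
    ext x
    simp [hA]
  have h1 := LinearMap.finrank_range_add_finrank_ker A.mulVecLin
  have h2 : Module.finrank (ZMod 2) (Submodule.span (ZMod 2) (Set.range A)) =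
      Module.finrank (ZMod 2) (LinearMap.range A.mulVecLin) :=
    (Matrix.rank_eq_finrank_span_row A).symm
  rw [natCard_eq_two_pow_finrank, natCard_eq_two_pow_finrank, ← pow_add, hC, h2, add_comm, h1]
  simp

/-- The size of a code, in terms of the radius `k₀ + M` at which balls in the coset graph of its
dual become large and of the growth rate `G` of the coset weight enumerator. -/
lemma natCard_mul_pow_le {w : ℕ} {z G δ : ℝ} (hz : 0 < z) (hz1 : z ≤ 1) (hG0 : 0 < G)
    (hG : IsGrowthBound w z G) (hδn : 1 < δ * n) {C : BinaryCode n}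
    (hC : HasParityCheckDensity w C) (hd : HasRelativeDistance δ C)
    {k₀ M m : ℕ} (hM : 2 ≤ M) (hk₀ : 0 < k₀) (hm : 0 < m) (hn : k₀ + M + m ≤ n)
    (hμ : n - 2 * (δ * n) + 1 ≤ 2 * √((k₀ : ℝ) * m) * (1 - 1 / ((M : ℝ) - 1))) :
    (Nat.card C : ℝ) * z ^ (k₀ + M) ≤ 2 * (δ * n) * G ^ n := by
  obtain ⟨r, A, hw, hA⟩ := hC
  set D := Submodule.span (ZMod 2) (Set.range A) with hD
  have hdist : ∀ y ∈ C, y ≠ 0 → δ * n ≤ hammingNorm y := by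
    intro y hy hy0
    simpa using hd y hy 0 C.zero_mem hy0
  have hdual : ∀ y ∉ C, ∃ d ∈ D, y ⬝ᵥ d ≠ 0 := by
    intro y hy
    rw [hA] at hy
    obtain ⟨i, hi⟩ := Function.ne_iff.1 hy
    refine ⟨A i, Submodule.subset_span ⟨i, rfl⟩, ?_⟩
    rwa [dotProduct_comm]
  have hball := two_pow_le_card_cosetWeight_le (by linarith) hdist hdual hM hk₀ hm hn hμ
  obtain ⟨S, hS⟩ : ∃ S : Finset (Fin n → ZMod 2), (S : Set (Fin n → ZMod 2)) = Set.range A :=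
    (Set.finite_range _).exists_finset_coe
  have hAS : ∀ i, A i ∈ S := fun i => by
    rw [← mem_coe, hS]
    exact ⟨i, rfl⟩
  have hSw : ∀ c ∈ S, hammingNorm c ≤ w := by
    intro c hc
    rw [← mem_coe, hS] at hc
    obtain ⟨i, rfl⟩ := hc
    exact hw i
  -- A coordinate missed by all parity checks would give a codeword of weight one.
  have hcover : S.biUnion vecSupport = univ := by
    refine eq_univ_iff_forall.2 fun i => ?_
    by_contra hi
    simp only [mem_biUnion, mem_vecSupport, not_exists, not_and, not_not] at hi
    have hmem : Pi.single i (1 : ZMod 2) ∈ C := by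
      rw [hA, Matrix.mulVec_single_one]
      ext j
      exact hi _ (hAS j)
    have h1 := hdist _ hmem (by simp)
    have h2 := hammingNorm_add_single (0 : Fin n → ZMod 2) i
    simp only [zero_add, Pi.zero_apply, if_true, hammingNorm_zero] at h2
    rw [h2] at h1
    push_cast at h1
    linarith
  have hsum := (sum_pow_cosetWeight_span_le hz hz1 hG0 hG S hSw).2
  rw [hcover, hS, ← hD, card_univ, Fintype.card_fin] at hsum
  have huniv : supportedOn (univ : Finset (Fin n)) = univ := by
    ext x
    simp
  rw [huniv] at hsum
  set B := univ.filter fun x : Fin n → ZMod 2 => cosetWeight D x ≤ k₀ + M with hB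
  have hBz : B.card * z ^ (k₀ + M) ≤ Nat.card D * G ^ n := by
    refine le_trans ?_ hsum
    refine le_trans ?_ (sum_le_sum_of_subset_of_nonneg (subset_univ B) fun x _ _ => by positivity)
    rw [← nsmul_eq_mul]
    refine card_nsmul_le_sum _ _ _ fun x hx => ?_
    exact pow_le_pow_of_le_one hz.le hz1 (mem_filter.1 hx).2
  have hCD : (Nat.card C * Nat.card D : ℝ) ≤ 2 ^ n := by
    exact_mod_cast natCard_mul_natCard_span_rows_le hA
  have hDpos : (0 : ℝ) < Nat.card D := by exact_mod_cast Nat.card_pos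
  refine le_of_mul_le_mul_right ?_ hDpos
  calc (Nat.card C : ℝ) * z ^ (k₀ + M) * Nat.card D
      = (Nat.card C * Nat.card D) * z ^ (k₀ + M) := by ring
    _ ≤ (2 * (δ * n) * B.card) * z ^ (k₀ + M) := by
        exact mul_le_mul_of_nonneg_right (hCD.trans hball) (by positivity)
    _ = 2 * (δ * n) * (B.card * z ^ (k₀ + M)) := by ring
    _ ≤ 2 * (δ * n) * (Nat.card D * G ^ n) := by
        gcongr
    _ = _ := by ring

lemma codeRate_le {w : ℕ} {z G δ : ℝ} (hz : 0 < z) (hz1 : z ≤ 1) (hG0 : 0 < G)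
    (hG : IsGrowthBound w z G) (hδ : δ ≤ 1 / 2) (hn0 : 0 < n) (hδn : 1 < δ * n) {C : BinaryCode n}
    (hC : HasParityCheckDensity w C) (hd : HasRelativeDistance δ C)
    {k₀ M m : ℕ} (hM : 2 ≤ M) (hk₀ : 0 < k₀) (hm : 0 < m) (hn : k₀ + M + m ≤ n)
    (hμ : n - 2 * (δ * n) + 1 ≤ 2 * √((k₀ : ℝ) * m) * (1 - 1 / ((M : ℝ) - 1))) :
    codeRate C ≤ Real.logb 2 n / n + ((k₀ : ℝ) / n + M / n) * -Real.logb 2 z + Real.logb 2 G := by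
  have hn' : (0 : ℝ) < n := by exact_mod_cast hn0
  have hCpos : (0 : ℝ) < Nat.card C := by exact_mod_cast Nat.card_pos
  have h : (Nat.card C : ℝ) * z ^ (k₀ + M) ≤ n * G ^ n := by
    refine (natCard_mul_pow_le hz hz1 hG0 hG hδn hC hd hM hk₀ hm hn hμ).trans ?_
    gcongr
    nlinarith
  have hlog := Real.logb_le_logb_of_le one_lt_two (by positivity) h
  rw [Real.logb_mul hCpos.ne' (by positivity), Real.logb_mul hn'.ne' (by positivity),
    Real.logb_pow, Real.logb_pow] at hlog
  unfold codeRate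
  rw [div_le_iff₀ hn']
  have e : (Real.logb 2 n / n + ((k₀ : ℝ) / n + M / n) * -Real.logb 2 z + Real.logb 2 G) * n =
      Real.logb 2 n + n * Real.logb 2 G - (k₀ + M) * Real.logb 2 z := by
    field_simp
    ring
  rw [e]
  push_cast at hlog
  linarith

lemma hasParityCheckDensity_bot {w : ℕ} (hw : 1 ≤ w) :
    HasParityCheckDensity w (⊥ : BinaryCode n) := by
  refine ⟨n, 1, fun i => ?_, fun x => by simp⟩
  have h : (1 : Matrix (Fin n) (Fin n) (ZMod 2)) i = 0 + Pi.single i 1 := by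
    ext j
    simp [Matrix.one_apply, Pi.single_apply, eq_comm]
  rw [h, hammingNorm_add_single]
  simpa using hw

lemma hasRelativeDistance_bot (δ : ℝ) : HasRelativeDistance δ (⊥ : BinaryCode n) := by
  intro x hx y hy hxy
  rw [Submodule.mem_bot] at hx hy
  exact absurd (hx.trans hy.symm) hxy

lemma codeRate_nonneg (C : BinaryCode n) : 0 ≤ codeRate C := by
  refine div_nonneg (Real.logb_nonneg one_lt_two ?_) (Nat.cast_nonneg _)
  exact_mod_cast Nat.card_pos

lemma maxRate_nonneg (w : ℕ) (δ : ℝ) (n : ℕ) : 0 ≤ maxRate w δ n := by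
  refine Real.sSup_nonneg ?_
  rintro r ⟨C, -, -, rfl⟩
  exact codeRate_nonneg C

open Filter Topology

/-- The eigenvalue condition on the radius holds for all long codes as soon as the relative radius
`σ` satisfies `2 √(σ (1 - σ)) > 1 - 2δ`: a band of constant width `M` suffices. -/
lemma exists_band {δ σ : ℝ} (hσ : 0 < σ) (hσ' : σ < 1)
    (h : 1 - 2 * δ < 2 * √(σ * (1 - σ))) :
    ∃ M : ℕ, 2 ≤ M ∧ ∀ᶠ n : ℕ in atTop, ∃ m : ℕ, 0 < ⌊σ * n⌋₊ ∧ 0 < m ∧ ⌊σ * n⌋₊ + M + m ≤ n ∧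
      (n : ℝ) - 2 * (δ * n) + 1 ≤
        2 * √((⌊σ * n⌋₊ : ℝ) * m) * (1 - 1 / ((M : ℝ) - 1)) := by
  have hM : ∀ᶠ M : ℕ in atTop, 1 - 2 * δ < 2 * √(σ * (1 - σ)) * (1 - 1 / ((M : ℝ) - 1)) := by
    have h1 : Tendsto (fun M : ℕ => 2 * √(σ * (1 - σ)) * (1 - 1 / ((M : ℝ) - 1))) atTop
        (𝓝 (2 * √(σ * (1 - σ)) * (1 - 0))) := by
      refine Tendsto.const_mul _ (Tendsto.const_sub _ ?_)
      simp_rw [one_div]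
      exact (tendsto_atTop_add_const_right _ (-1) tendsto_natCast_atTop_atTop).inv_tendsto_atTop
    rw [sub_zero, mul_one] at h1
    exact h1.eventually (lt_mem_nhds h)
  obtain ⟨M, hM1, hM2⟩ := (hM.and (eventually_ge_atTop 2)).exists
  refine ⟨M, hM2, ?_⟩
  have hfl : Tendsto (fun n : ℕ => (⌊σ * n⌋₊ : ℝ) / n) atTop (𝓝 σ) :=
    (tendsto_nat_floor_mul_div_atTop hσ.le).comp tendsto_natCast_atTop_atTop
  have hc : ∀ c : ℝ, Tendsto (fun n : ℕ => c / (n : ℝ)) atTop (𝓝 0) :=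
    fun c => tendsto_const_div_atTop_nhds_zero_nat c
  have hrem : Tendsto (fun n : ℕ => 1 - (⌊σ * n⌋₊ : ℝ) / n - M / n) atTop (𝓝 (1 - σ - 0)) :=
    (hfl.const_sub 1).sub (hc M)
  rw [sub_zero] at hrem
  have hlim : Tendsto (fun n : ℕ => 2 * √((⌊σ * n⌋₊ : ℝ) / n * (1 - (⌊σ * n⌋₊ : ℝ) / n - M / n)) *
      (1 - 1 / ((M : ℝ) - 1)) - 1 / n) atTop
      (𝓝 (2 * √(σ * (1 - σ)) * (1 - 1 / ((M : ℝ) - 1)) - 0)) :=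
    (((hfl.mul hrem).sqrt.const_mul 2).mul_const _).sub (hc 1)
  rw [sub_zero] at hlim
  filter_upwards [hlim.eventually (lt_mem_nhds hM1), hfl.eventually (lt_mem_nhds hσ),
    hrem.eventually (lt_mem_nhds (sub_pos.2 hσ')), eventually_gt_atTop 0] with n h1 h2 h3 hn
  have hn' : (0 : ℝ) < n := by exact_mod_cast hn
  have hk : (0 : ℝ) < ⌊σ * n⌋₊ := by
    have := mul_pos h2 hn'
    rwa [div_mul_cancel₀ _ hn'.ne'] at this
  have hm : (⌊σ * n⌋₊ : ℝ) + M < n := by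
    have := mul_pos h3 hn'
    rw [sub_mul, sub_mul, div_mul_cancel₀ _ hn'.ne', div_mul_cancel₀ _ hn'.ne'] at this
    linarith
  have hm' : ⌊σ * n⌋₊ + M < n := by exact_mod_cast hm
  refine ⟨n - (⌊σ * n⌋₊ + M), by exact_mod_cast hk, by omega, by omega, ?_⟩
  have e : √((⌊σ * n⌋₊ : ℝ) * ((n - (⌊σ * n⌋₊ + M) : ℕ) : ℝ)) =
      n * √((⌊σ * n⌋₊ : ℝ) / n * (1 - (⌊σ * n⌋₊ : ℝ) / n - M / n)) := by
    rw [Nat.cast_sub hm'.le, ← Real.sqrt_sq hn'.le, ← Real.sqrt_mul (by positivity),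
      Real.sqrt_sq hn'.le]
    congr 1
    push_cast
    field_simp
    ring
  rw [e]
  have h4 := mul_lt_mul_of_pos_right h1 hn'
  rw [sub_mul _ (1 / (n : ℝ)), div_mul_cancel₀ _ hn'.ne'] at h4
  linarith

/-- A growth rate `G` at `z` bounds the asymptotic rate: `|C|` is, up to a subexponential factor,
at most the size of the ball of relative radius `ρ` in the coset graph of the dual code, which is at
most `(z ^ (-ρ) G) ^ n`. -/
theorem asymptoticRate_le {w : ℕ} (hw : 1 ≤ w) {z G δ ρ : ℝ} (hz : 0 < z) (hz1 : z ≤ 1)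
    (hG0 : 0 < G) (hG : IsGrowthBound w z G) (hδ : 0 < δ) (hδ' : δ < 1 / 2)
    (hρ : ρ = 1 / 2 - √(δ * (1 - δ))) :
    asymptoticRate w δ ≤ ρ * -Real.logb 2 z + Real.logb 2 G := by
  have hs0 : 0 < √(δ * (1 - δ)) := Real.sqrt_pos.2 (mul_pos hδ (by linarith))
  have hsq : √(δ * (1 - δ)) ^ 2 = δ * (1 - δ) := Real.sq_sqrt (mul_nonneg hδ.le (by linarith))
  have hs1 : √(δ * (1 - δ)) < 1 / 2 := by nlinarith
  have hrate : ∀ σ, ρ < σ → σ < 1 / 2 →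
      asymptoticRate w δ ≤ σ * -Real.logb 2 z + Real.logb 2 G := by
    intro σ hσ hσ'
    have hgap : 1 - 2 * δ < 2 * √(σ * (1 - σ)) := by
      have h1 : 1 / 2 - δ < √(σ * (1 - σ)) := by
        refine Real.lt_sqrt_of_sq_lt ?_
        nlinarith
      linarith
    obtain ⟨M, hM, hev⟩ := exists_band (by linarith) (by linarith) hgap
    have hlim : Tendsto (fun n : ℕ => Real.logb 2 n / n +
        ((⌊σ * n⌋₊ : ℝ) / n + M / n) * -Real.logb 2 z + Real.logb 2 G) atTop
        (𝓝 (0 + (σ + 0) * -Real.logb 2 z + Real.logb 2 G)) := by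
      refine Tendsto.add_const _ (Tendsto.add ?_ (Tendsto.mul_const _ (Tendsto.add ?_ ?_)))
      · have h1 : Tendsto (fun x : ℝ => Real.log x / x) atTop (𝓝 0) :=
          Real.isLittleO_log_id_atTop.tendsto_div_nhds_zero
        have h2 := (h1.comp tendsto_natCast_atTop_atTop).div_const (Real.log 2)
        rw [zero_div] at h2
        refine h2.congr fun n => ?_
        simp only [Function.comp_apply, Real.logb]
        ring
      · exact (tendsto_nat_floor_mul_div_atTop (by linarith)).comp tendsto_natCast_atTop_atTop
      · exact tendsto_const_div_atTop_nhds_zero_nat _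
    rw [zero_add, add_zero] at hlim
    rw [← hlim.limsup_eq]
    refine limsup_le_limsup ?_ ?_ hlim.isBoundedUnder_le
    · have hδn : ∀ᶠ n : ℕ in atTop, 1 < δ * n :=
        (tendsto_natCast_atTop_atTop.const_mul_atTop hδ).eventually_gt_atTop 1
      filter_upwards [hev, hδn, eventually_gt_atTop 0] with n hn h1 hn0
      obtain ⟨m, hk, hm, hle, hμ⟩ := hn
      refine csSup_le ⟨_, ⊥, hasParityCheckDensity_bot hw, hasRelativeDistance_bot δ, rfl⟩ ?_
      rintro r ⟨C, hC, hd, rfl⟩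
      exact codeRate_le hz hz1 hG0 hG hδ'.le hn0 h1 hC hd hM hk hm hle hμ
    · exact IsBoundedUnder.isCoboundedUnder_le
        (isBoundedUnder_of ⟨0, fun n => maxRate_nonneg w δ n⟩)
  have hcont : Tendsto (fun σ => σ * -Real.logb 2 z + Real.logb 2 G) (𝓝[>] ρ)
      (𝓝 (ρ * -Real.logb 2 z + Real.logb 2 G)) :=
    ((tendsto_id.mul_const _).add_const _).mono_left nhdsWithin_le_nhds
  refine ge_of_tendsto hcont ?_
  filter_upwards [Ioo_mem_nhdsGT (show ρ < 1 / 2 by linarith)] with σ hσ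
  exact hrate σ hσ.1 hσ.2

/-! ### The optimal parameters -/

/-- `z = ρ / (1 - ρ)` minimizes `z ^ (-ρ) (1 + z)`, with minimal value `2 ^ H(ρ)`. -/
lemma entropy2_eq {ρ : ℝ} (h0 : 0 < ρ) (h1 : ρ < 1) :
    entropy2 ρ = ρ * -Real.logb 2 (ρ / (1 - ρ)) - Real.logb 2 (1 - ρ) := by
  rw [entropy2, Real.logb_div h0.ne' (by linarith)]
  ring

/-- `z = ρ / (1 - 3ρ)` minimizes `z ^ (-ρ) (1 + 3z) ^ (1/3)`. -/
lemma two_thirds_entropy4_eq {ρ : ℝ} (h0 : 0 < ρ) (h1 : ρ < 1 / 3) :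
    2 / 3 * entropy4 (3 * ρ) =
      ρ * -Real.logb 2 (ρ / (1 - 3 * ρ)) - 1 / 3 * Real.logb 2 (1 - 3 * ρ) := by
  have h4 : ∀ x, Real.logb 4 x = Real.logb 2 x / 2 := by
    intro x
    have : Real.log 4 = 2 * Real.log 2 := by
      rw [show (4 : ℝ) = 2 ^ 2 by norm_num, Real.log_pow]
      norm_num
    rw [Real.logb, Real.logb, this]
    ring
  rw [entropy4, h4, h4, h4, Real.logb_div h0.ne' (by linarith),
    Real.logb_mul three_ne_zero h0.ne']
  ring

end LDPC

theorem mainTheorem2 (δ : ℝ) (hδ : 0 < δ) (hδ' : δ < 1 / 2)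
    (ρ : ℝ) (hρ : ρ = 1 / 2 - Real.sqrt (δ * (1 - δ))) :
    (∀ w : ℕ, 3 ≤ w →
      LDPC.asymptoticRate w δ ≤
        LDPC.entropy2 ρ - 1 / (w : ℝ) * Real.logb 2 (1 + (ρ / (1 - ρ)) ^ w)) ∧
    (δ ≤ 1 / 2 - Real.sqrt 3 / 4 → LDPC.asymptoticRate 3 δ ≤ 2 / 3) ∧
    (1 / 2 - Real.sqrt 3 / 4 < δ → LDPC.asymptoticRate 3 δ ≤ 2 / 3 * LDPC.entropy4 (3 * ρ)) ∧
    LDPC.asymptoticRate 4 δ ≤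
      LDPC.entropy2 ρ + 1 / 4 * Real.logb 2 (LDPC.quarticF ρ) := by
  have hs0 : 0 < √(δ * (1 - δ)) := Real.sqrt_pos.2 (mul_pos hδ (by linarith))
  have hsq : √(δ * (1 - δ)) ^ 2 = δ * (1 - δ) := Real.sq_sqrt (mul_nonneg hδ.le (by linarith))
  have hρ0 : 0 < ρ := by nlinarith
  have hρ1 : ρ < 1 / 2 := by linarith
  have h1ρ : 0 < 1 - ρ := by linarith
  have hz : 0 < ρ / (1 - ρ) := div_pos hρ0 h1ρ
  have hz1 : ρ / (1 - ρ) ≤ 1 := by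
    rw [div_le_one h1ρ]
    linarith
  have hroot : ∀ (x : ℝ) (k : ℕ), 0 < x → k ≠ 0 →
      0 < x ^ (1 / (k : ℝ)) ∧ (x ^ (1 / (k : ℝ))) ^ k = x ∧
        Real.logb 2 (x ^ (1 / (k : ℝ))) = 1 / k * Real.logb 2 x := by
    intro x k hx hk
    refine ⟨Real.rpow_pos_of_pos hx _, ?_, Real.logb_rpow_eq_mul_logb_of_pos hx⟩
    rw [one_div, Real.rpow_inv_natCast_pow hx.le hk]
  refine ⟨?_, ?_, ?_, ?_⟩
  · intro w hw
    have hzw : 0 < 1 + (ρ / (1 - ρ)) ^ w := by positivity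
    obtain ⟨hr0, -, hrlog⟩ := hroot _ w hzw (by omega)
    have h := LDPC.asymptoticRate_le (by omega : 1 ≤ w) hz hz1 (by positivity)
      (LDPC.isGrowthBound_general hz hz1) hδ hδ' hρ
    rw [Real.logb_div (by positivity) hr0.ne', hrlog,
      show 1 + ρ / (1 - ρ) = (1 - ρ)⁻¹ by field_simp; ring, Real.logb_inv] at h
    rw [LDPC.entropy2_eq hρ0 (by linarith)]
    linarith
  · intro _
    obtain ⟨hr0, hr3, hrlog⟩ := hroot 4 3 (by norm_num) (by norm_num)
    have h := LDPC.asymptoticRate_le (by norm_num : 1 ≤ 3) one_pos le_rfl hr0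
      (LDPC.isGrowthBound_three one_pos le_rfl hr0 (by rw [hr3]; norm_num)) hδ hδ' hρ
    have h4 : Real.logb 2 4 = 2 := by
      rw [show (4 : ℝ) = 2 ^ (2 : ℝ) by norm_num, Real.logb_rpow two_pos (by norm_num)]
    rw [hrlog, h4, Real.logb_one] at h
    norm_num at h ⊢
    exact h
  · intro hδ3
    -- The threshold on `δ` is where `ρ = 1 / 4`, that is, where `z = ρ / (1 - 3ρ)` reaches `1`.
    have hρ4 : ρ < 1 / 4 := by
      have h3 : √3 ^ 2 = 3 := Real.sq_sqrt (by norm_num)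
      have : 1 / 4 < √(δ * (1 - δ)) := by
        refine Real.lt_sqrt_of_sq_lt ?_
        nlinarith [Real.sqrt_nonneg 3]
      linarith
    have h3ρ : 0 < 1 - 3 * ρ := by linarith
    have hy : 0 < ρ / (1 - 3 * ρ) := div_pos hρ0 h3ρ
    have hy1 : ρ / (1 - 3 * ρ) ≤ 1 := by
      rw [div_le_one h3ρ]
      linarith
    obtain ⟨hr0, hr3, hrlog⟩ := hroot (1 - 3 * ρ)⁻¹ 3 (by positivity) (by norm_num)
    have h := LDPC.asymptoticRate_le (by norm_num : 1 ≤ 3) hy hy1 hr0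
      (LDPC.isGrowthBound_three hy hy1 hr0 (by rw [hr3]; field_simp; ring)) hδ hδ' hρ
    rw [hrlog, Real.logb_inv] at h
    rw [LDPC.two_thirds_entropy4_eq hρ0 (by linarith)]
    push_cast at h
    linarith
  · have hF : 0 < LDPC.quarticF ρ := by
      unfold LDPC.quarticF
      positivity
    obtain ⟨hr0, hr4, hrlog⟩ := hroot (LDPC.quarticF ρ) 4 hF (by norm_num)
    have h := LDPC.asymptoticRate_le (by norm_num : 1 ≤ 4) hz hz1 (div_pos hr0 h1ρ)
      (LDPC.isGrowthBound_four hz hz1 (div_pos hr0 h1ρ) (by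
        rw [div_pow, hr4, LDPC.quarticF]
        field_simp)) hδ hδ' hρ
    rw [Real.logb_div hr0.ne' h1ρ.ne', hrlog] at h
    rw [LDPC.entropy2_eq hρ0 (by linarith)]
    push_cast at h
    linarith
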